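/- Consider a finite discounted Markov decision process with state space $\mathcal S$, action space $\mathcal A$, transition probabilities $P(s'\mid s,a)$ and discount factor $\gamma\in(0,1)$. Let $P\in\mathbb R^{|\mathcal S||\mathcal A|\times|\mathcal S|}$ be the matrix with entries $P(s'\mid s,a)$, let $\Phi\in\mathbb R^{|\mathcal S||\mathcal A|\times m}$ have full column rank, let $d$ be a probability distribution on $\mathcal S\times\mathcal A$ with $d(s,a)>0$ for all $(s,a)$, put $D:=\operatorname{diag}(d)$, and let $\alpha\in(0,1)$. For a deterministic policy $\pi:\mathcal S\to\mathcal A$ let $\Pi^\pi\in\mathbb R^{|\mathcal S|\times|\mathcal S||\mathcal A|}$ be the matrix whose row $s$ has the entry $1$ at $(s,\pi(s))$ and $0$ elsewhere, and let $$A_\pi:=I-\alpha\Phi^\top D\Phi+\alpha\gamma\Phi^\top DP\Pi^\pi\Phi\in\mathbb R^{m\times m},\qquad \mathcal A_\alpha:=\{A_\pi:\ \pi:\mathcal S\to\mathcal A\}.$$ Let $\operatorname{co}(\mathcal A_\alpha)$ be its convex hull and let $$\rho_\alpha^{\mathrm{dir}}:=\lim_{k\to\infty}\ \max_{A_1,\dots,A_k\in\mathcal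 A_\alpha}\|A_k\cdots A_1\|_2^{1/k}$$ be its joint spectral radius. For $\varepsilon>0$ and $x\in\mathbb R^m$ put $$V_\varepsilon^t(x):=\sum_{\ell=0}^{t}(\rho_\alpha^{\mathrm{dir}}+\varepsilon)^{-2\ell}\max_{\pi_1,\dots,\pi_\ell}\|A_{\pi_\ell}\cdots A_{\pi_1}x\|_2^2,\qquad V_\varepsilon^\infty(x):=\lim_{t\to\infty}V_\varepsilon^t(x),\qquad p_\varepsilon(x):=\sqrt{V_\varepsilon^\infty(x)},$$ the maximum being over deterministic policies, and the term $\ell=0$ being $\|x\|_2^2$. Consider the switched linear inclusion $$x_{k+1}=A_kx_k,\qquad A_k\in\operatorname{co}(\mathcal A_\alpha),\qquad k=0,1,\dots\qquad(\ast)$$ (i) Suppose $\rho_\alpha^{\mathrm{dir}}<1$. Then $(\ast)$ is uniformly exponentially stable under arbitrary switching: there exist $C\ge1$ and $\eta\in(0,1)$ such that $$\|A_{k-1}\cdots A_0x\|_2\le C\eta^k\|x\|_2$$ for every $k\ge0$, every $x\in\mathbb R^m$ and every sequence $A_0,A_1,\ldots\in\operatorname{co}(\mathcal A_\alpha)$.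 More specifically, for every $\varepsilon>0$ with $\rho_\alpha^{\mathrm{dir}}+\varepsilon<1$, the limit $V_\varepsilon^\infty(x)$ exists (and is finite) for every $x\in\mathbb R^m$, $p_\varepsilon$ is a norm on $\mathbb R^m$, and $$p_\varepsilon(Ax)\le(\rho_\alpha^{\mathrm{dir}}+\varepsilon)\,p_\varepsilon(x)\qquad\text{for all }A\in\operatorname{co}(\mathcal A_\alpha),\ x\in\mathbb R^m.$$ (ii) Suppose $\rho_\alpha^{\mathrm{dir}}>1$. Then $(\ast)$ has a trajectory with a periodic switching sequence ($A_{k+\ell}=A_k$ for all $k$ and some $\ell\ge1$) whose state $x_k$ does not converge to $0$. -/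

import Mathlib

open Filter Topology

namespace DirectInclusion

noncomputable section

/-! ### Switched linear systems and the joint spectral radius -/

/-- The product `w (k-1) * ⋯ * w 1 * w 0` of a word of `k` matrices, the letter with index `0`
acting first; the empty word gives the identity. -/
def wordProd {m : ℕ} : (k : ℕ) → (Fin k → Matrix (Fin m) (Fin m) ℝ) → Matrix (Fin m) (Fin m) ℝ
  | 0, _ => 1
  | k + 1, w => w (Fin.last k) * wordProd k (fun j => w j.castSucc)

/-- The linear action of a matrix on `ℝ^m` with its Euclidean norm. -/
def act {m : ℕ} (M : Matrix (Fin m) (Fin m) ℝ) (x : EuclideanSpace ℝ (Fin m)) :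
    EuclideanSpace ℝ (Fin m) :=
  WithLp.toLp 2 (M.mulVec x.ofLp)

/-- The largest operator norm (induced by the Euclidean norm) of a product of `k` matrices
of `H`. -/
def maxProdNorm {m : ℕ} (H : Set (Matrix (Fin m) (Fin m) ℝ)) (k : ℕ) : ℝ :=
  ⨆ w : Fin k → H, ‖Matrix.toEuclideanCLM (𝕜 := ℝ) (wordProd k (fun j => (w j).1))‖

/-- The joint spectral radius
`lim_{k → ∞} sup_{A_1, …, A_k ∈ H} ‖A_k ⋯ A_1‖^{1/k}` of a bounded set of matrices.
The limit exists by `tendsto_jsr` below. -/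
def jsr {m : ℕ} (H : Set (Matrix (Fin m) (Fin m) ℝ)) : ℝ :=
  limUnder atTop (fun k : ℕ => maxProdNorm H k ^ (1 / (k : ℝ)))

/-! ### The limit in the definition of the joint spectral radius exists -/

theorem wordProd_add {m a : ℕ} : ∀ (b : ℕ) (w : Fin (a + b) → Matrix (Fin m) (Fin m) ℝ),
    wordProd (a + b) w = wordProd b (fun j => w (Fin.natAdd a j)) *
      wordProd a (fun j => w (Fin.castAdd b j))
  | 0, w => by simp [wordProd]
  | b + 1, w => by
      have h := wordProd_add b (fun j => w j.castSucc)
      change w (Fin.last (a + b)) * wordProd (a + b) (fun j => w j.castSucc) = _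
      rw [h, ← mul_assoc]
      rfl

theorem norm_wordProd_le {m : ℕ} {B : ℝ} (hB : 1 ≤ B) :
    ∀ (k : ℕ) (w : Fin k → Matrix (Fin m) (Fin m) ℝ),
      (∀ j, ‖Matrix.toEuclideanCLM (𝕜 := ℝ) (w j)‖ ≤ B) →
      ‖Matrix.toEuclideanCLM (𝕜 := ℝ) (wordProd k w)‖ ≤ B ^ k
  | 0, w, _ => by
      simp only [wordProd, map_one, pow_zero]
      exact ContinuousLinearMap.norm_id_le
  | k + 1, w, h => by
      simp only [wordProd, map_mul, pow_succ']
      exact (norm_mul_le _ _).trans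
        (mul_le_mul (h _) (norm_wordProd_le hB k _ fun j => h _) (norm_nonneg _) (by linarith))

/-- Fekete's lemma in multiplicative form. -/
theorem exists_tendsto_root {a : ℕ → ℝ} (h0 : ∀ n, 0 ≤ a n)
    (hsub : ∀ p q, a (p + q) ≤ a p * a q) :
    ∃ L, Tendsto (fun k : ℕ => a k ^ (1 / (k : ℝ))) atTop (𝓝 L) := by
  have key : ∀ c : ℝ, 0 < c →
      ∃ L, Tendsto (fun k : ℕ => max (a k ^ (1 / (k : ℝ))) c) atTop (𝓝 L) := by
    intro c hc
    have hpos : ∀ n, 0 < max (a n) (c ^ n) := fun n => lt_max_of_lt_right (pow_pos hc n)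
    have hs : Subadditive (fun n => Real.log (max (a n) (c ^ n))) := by
      intro p q
      rw [← Real.log_mul (hpos p).ne' (hpos q).ne']
      refine Real.log_le_log (hpos _) (max_le ((hsub p q).trans ?_) ?_)
      · exact mul_le_mul (le_max_left _ _) (le_max_left _ _) (h0 q) (hpos p).le
      · rw [pow_add]
        exact mul_le_mul (le_max_right _ _) (le_max_right _ _) (pow_pos hc q).le (hpos p).le
    have hb : BddBelow (Set.range fun n : ℕ => Real.log (max (a n) (c ^ n)) / n) := by
      refine ⟨min 0 (Real.log c), ?_⟩
      rintro _ ⟨n, rfl⟩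
      rcases Nat.eq_zero_or_pos n with rfl | hn
      · simp
      · refine (min_le_right _ _).trans ?_
        have hn' : (0 : ℝ) < n := by exact_mod_cast hn
        rw [le_div_iff₀ hn', mul_comm, ← Real.log_pow]
        exact Real.log_le_log (pow_pos hc n) (le_max_right _ _)
    refine ⟨Real.exp hs.lim, ?_⟩
    refine ((Real.continuous_exp.tendsto _).comp (hs.tendsto_lim hb)).congr' ?_
    filter_upwards [eventually_gt_atTop 0] with n hn
    have hn' : (0 : ℝ) < n := by exact_mod_cast hn
    have hc' : (c ^ n) ^ (1 / (n : ℝ)) = c := by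
      rw [one_div]; exact Real.pow_rpow_inv_natCast hc.le hn.ne'
    have hmono : Monotone fun y : ℝ => (max y 0) ^ (1 / (n : ℝ)) := fun y z hyz =>
      Real.rpow_le_rpow (le_max_right _ _) (max_le_max hyz le_rfl) (by positivity)
    have hm := hmono.map_max (a := a n) (b := c ^ n)
    simp only [max_eq_left (h0 n), max_eq_left (pow_pos hc n).le, max_eq_left (hpos n).le,
      hc'] at hm
    rw [← hm, Function.comp_apply, Real.rpow_def_of_pos (hpos n)]
    congr 1
    ring
  by_cases hex : ∃ c : ℝ, 0 < c ∧ ∃ L, c < L ∧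
      Tendsto (fun k : ℕ => max (a k ^ (1 / (k : ℝ))) c) atTop (𝓝 L)
  · obtain ⟨c, -, L, hcL, hL⟩ := hex
    refine ⟨L, hL.congr' ?_⟩
    filter_upwards [hL.eventually (lt_mem_nhds hcL)] with k hk
    rcases lt_max_iff.1 hk with h | h
    · exact max_eq_left h.le
    · exact absurd h (lt_irrefl c)
  · push Not at hex
    refine ⟨0, tendsto_order.2 ⟨fun y hy => Eventually.of_forall fun k =>
      hy.trans_le (Real.rpow_nonneg (h0 k) _), fun y hy => ?_⟩⟩
    obtain ⟨L, hL⟩ := key (y / 2) (by linarith)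
    have hLy : L ≤ y / 2 := by
      by_contra hlt
      exact hex (y / 2) (by linarith) L (not_le.1 hlt) hL
    filter_upwards [hL.eventually (gt_mem_nhds (show L < y by linarith))] with k hk
    exact (le_max_left _ _).trans_lt hk

theorem tendsto_jsr {m : ℕ} {H : Set (Matrix (Fin m) (Fin m) ℝ)} (hne : H.Nonempty) {B : ℝ}
    (hB : ∀ M ∈ H, ‖Matrix.toEuclideanCLM (𝕜 := ℝ) M‖ ≤ B) :
    Tendsto (fun k : ℕ => maxProdNorm H k ^ (1 / (k : ℝ))) atTop (𝓝 (jsr H)) := by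
  have : Nonempty H := hne.to_subtype
  have hbdd : ∀ k, BddAbove (Set.range fun w : Fin k → H =>
      ‖Matrix.toEuclideanCLM (𝕜 := ℝ) (wordProd k (fun j => (w j).1))‖) := by
    intro k
    refine ⟨max B 1 ^ k, ?_⟩
    rintro _ ⟨w, rfl⟩
    exact norm_wordProd_le (le_max_right _ _) k _ fun j =>
      (hB _ (w j).2).trans (le_max_left _ _)
  have h0 : ∀ k, 0 ≤ maxProdNorm H k := fun k => Real.iSup_nonneg fun w => norm_nonneg _
  have hsub : ∀ p q, maxProdNorm H (p + q) ≤ maxProdNorm H p * maxProdNorm H q := by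
    intro p q
    refine ciSup_le fun w => ?_
    rw [wordProd_add, map_mul, mul_comm (maxProdNorm H p)]
    exact (norm_mul_le _ _).trans (mul_le_mul
      (le_ciSup (hbdd q) (fun j => w (Fin.natAdd p j)))
      (le_ciSup (hbdd p) (fun j => w (Fin.castAdd q j))) (norm_nonneg _) (h0 q))
  exact tendsto_nhds_limUnder (exists_tendsto_root h0 hsub)

/-! ### Stability and norms -/

/-- Uniform exponential stability under arbitrary switching of `x_{k+1} = M_k x_k`,
`M_k ∈ H`. -/
def UniformlyExponentiallyStable {m : ℕ} (H : Set (Matrix (Fin m) (Fin m) ℝ)) : Prop :=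
  ∃ C : ℝ, 1 ≤ C ∧ ∃ η : ℝ, 0 < η ∧ η < 1 ∧
    ∀ M : ℕ → Matrix (Fin m) (Fin m) ℝ, (∀ j, M j ∈ H) →
      ∀ (k : ℕ) (x : EuclideanSpace ℝ (Fin m)),
        ‖act (wordProd k (fun j => M j)) x‖ ≤ C * η ^ k * ‖x‖

/-- `x` is a trajectory of the switched system driven by the mode sequence `M`. -/
def IsTrajectory {m : ℕ} (M : ℕ → Matrix (Fin m) (Fin m) ℝ)
    (x : ℕ → EuclideanSpace ℝ (Fin m)) : Prop :=
  ∀ k, x (k + 1) = act (M k) (x k)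

/-- A real function on a real vector space is a norm. -/
structure IsNorm {E : Type*} [AddCommGroup E] [Module ℝ E] (p : E → ℝ) : Prop where
  nonneg : ∀ x, 0 ≤ p x
  eq_zero_iff : ∀ x, p x = 0 ↔ x = 0
  smul : ∀ (c : ℝ) (x : E), p (c • x) = |c| * p x
  add_le : ∀ x y, p (x + y) ≤ p x + p y

/-! ### Discounted Markov decision processes and the direct modes -/

/-- A finite discounted Markov decision process. -/
structure MDP (S A : Type*) [Fintype S] where
  /-- `prob s a s'` is the probability of moving to `s'` from `s` under the action `a`. -/
  prob : S → A → S → ℝ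
  prob_nonneg : ∀ s a s', 0 ≤ prob s a s'
  prob_sum : ∀ s a, ∑ s', prob s a s' = 1
  /-- The one-step reward. -/
  reward : S → A → S → ℝ
  /-- The discount factor. -/
  γ : ℝ
  γ_pos : 0 < γ
  γ_lt_one : γ < 1

section Modes

variable {S A : Type*} [Fintype S] [Fintype A] [DecidableEq S] [DecidableEq A] {m : ℕ}

/-- The transition matrix, with rows indexed by state-action pairs. -/
def MDP.transitionMatrix (𝓜 : MDP S A) : Matrix (S × A) S ℝ :=
  Matrix.of fun sa s' => 𝓜.prob sa.1 sa.2 s'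

/-- The matrix `Π^μ` of a stochastic policy: row `s` carries `μ(s)` on the entries `(s, ·)`. -/
def policyMatrix (μ : S → A → ℝ) : Matrix S (S × A) ℝ :=
  Matrix.of fun s sa => if sa.1 = s then μ s sa.2 else 0

/-- The one-hot encoding of a deterministic policy. -/
def oneHot (π : S → A) : S → A → ℝ :=
  fun s => Pi.single (π s) 1

/-- The direct mode `A_π = I - α Φᵀ D Φ + α γ Φᵀ D P Π^π Φ` of a deterministic policy,
`D = diag(d)`. -/
def mode (𝓜 : MDP S A) (d : S × A → ℝ) (Φ : Matrix (S × A) (Fin m) ℝ) (α : ℝ) (π : S → A) :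
    Matrix (Fin m) (Fin m) ℝ :=
  1 - α • (Φ.transpose * Matrix.diagonal d * Φ)
    + (α * 𝓜.γ) • (Φ.transpose * Matrix.diagonal d * 𝓜.transitionMatrix
        * policyMatrix (oneHot π) * Φ)

/-- The family `𝒜_α` of all direct modes of deterministic policies. -/
def modeFamily (𝓜 : MDP S A) (d : S × A → ℝ) (Φ : Matrix (S × A) (Fin m) ℝ) (α : ℝ) :
    Set (Matrix (Fin m) (Fin m) ℝ) :=
  Set.range (mode 𝓜 d Φ α)

/-- `ρ_α^dir`, the joint spectral radius of `𝒜_α`. -/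
def rhoDir (𝓜 : MDP S A) (d : S × A → ℝ) (Φ : Matrix (S × A) (Fin m) ℝ) (α : ℝ) : ℝ :=
  jsr (modeFamily 𝓜 d Φ α)

/-- `V_ε^t(x) = ∑_{ℓ ≤ t} β^{-2ℓ} max_{π_1, …, π_ℓ} ‖A_{π_ℓ} ⋯ A_{π_1} x‖²` with
`β = ρ_α^dir + ε`; the supremum is over the finite set of words of `ℓ` deterministic policies. -/
def lyapunovTrunc (𝓜 : MDP S A) (d : S × A → ℝ) (Φ : Matrix (S × A) (Fin m) ℝ) (α ε : ℝ)
    (t : ℕ) (x : EuclideanSpace ℝ (Fin m)) : ℝ :=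
  ∑ l ∈ Finset.range (t + 1), ((rhoDir 𝓜 d Φ α + ε) ^ (2 * l))⁻¹ *
    ⨆ w : Fin l → S → A, ‖act (wordProd l (fun j => mode 𝓜 d Φ α (w j))) x‖ ^ 2

/-- `V_ε^∞(x) = lim_{t → ∞} V_ε^t(x)`. -/
def lyapunov (𝓜 : MDP S A) (d : S × A → ℝ) (Φ : Matrix (S × A) (Fin m) ℝ) (α ε : ℝ)
    (x : EuclideanSpace ℝ (Fin m)) : ℝ :=
  limUnder atTop (fun t : ℕ => lyapunovTrunc 𝓜 d Φ α ε t x)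

/-- `p_ε(x) = √(V_ε^∞(x))`. -/
def pNorm (𝓜 : MDP S A) (d : S × A → ℝ) (Φ : Matrix (S × A) (Fin m) ℝ) (α ε : ℝ)
    (x : EuclideanSpace ℝ (Fin m)) : ℝ :=
  √(lyapunov 𝓜 d Φ α ε x)

end Modes

end

end DirectInclusion

namespace DirectInclusion

noncomputable section

/-! ### The linear action and products of words -/

section Act

variable {m : ℕ}

/-! Part (i). If `β` exceeds the joint spectral radius, products of length `l` have norm eventually
below `t ^ l` for some `t < β`, so the weighted series converges. Its square root is the ℓ² norm of
the sequence of seminorms `growth B l x / β ^ l`, hence a norm. Applying a mode shifts this sequence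
by one place at the cost of a factor `β` (`weightedNorm_act_le`). Convexity of the norm extends the
bound to the convex hull, and equivalence with the Euclidean norm turns it into stability.

Part (ii) is a quantitative form of the hard half of the Berger–Wang theorem. If all periodic
trajectories decay, every nonempty product of modes has spectral radius below `1`. Take `t` just
above the joint spectral radius `ρ > 1` and the norm `p` of part (i) with `β = t`. Some product of
length `N` stretches some vector by more than `t ^ N / 2` (`exists_lt_act_wordProd`), so the orbit
points, rescaled by powers of `t`, have `p`-norm between `1/2` and `1`. A volume count puts two of
them within `δ` (`IsNorm.exists_dist_lt`): a rescaled subword `P = t⁻ᵏ W` is a `p`-contraction with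
an almost fixed vector. But the eigenvalues of `P` have modulus at most `1/ρ`, and Cayley–Hamilton
then bounds `(1 - P)⁻¹` (`IsNorm.le_sub_act`). Neither this bound nor the count depends on the norm,
so `δ`, `N` and `t` can be fixed in this order. -/

theorem act_eq_toEuclideanCLM (M : Matrix (Fin m) (Fin m) ℝ) (x : EuclideanSpace ℝ (Fin m)) :
    act M x = Matrix.toEuclideanCLM (𝕜 := ℝ) M x := rfl

theorem act_mul (M N : Matrix (Fin m) (Fin m) ℝ) (x : EuclideanSpace ℝ (Fin m)) :
    act (M * N) x = act M (act N x) := by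
  simp [act_eq_toEuclideanCLM, map_mul]

theorem act_one (x : EuclideanSpace ℝ (Fin m)) : act 1 x = x := by
  simp [act_eq_toEuclideanCLM]

theorem act_add_right (M : Matrix (Fin m) (Fin m) ℝ) (x y : EuclideanSpace ℝ (Fin m)) :
    act M (x + y) = act M x + act M y := by
  simp [act_eq_toEuclideanCLM]

theorem act_sub_right (M : Matrix (Fin m) (Fin m) ℝ) (x y : EuclideanSpace ℝ (Fin m)) :
    act M (x - y) = act M x - act M y := by
  simp [act_eq_toEuclideanCLM]

theorem act_smul_right (M : Matrix (Fin m) (Fin m) ℝ) (c : ℝ) (x : EuclideanSpace ℝ (Fin m)) :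
    act M (c • x) = c • act M x := by
  simp [act_eq_toEuclideanCLM]

theorem act_add_left (M N : Matrix (Fin m) (Fin m) ℝ) (x : EuclideanSpace ℝ (Fin m)) :
    act (M + N) x = act M x + act N x := by
  simp [act_eq_toEuclideanCLM]

theorem act_smul_left (c : ℝ) (M : Matrix (Fin m) (Fin m) ℝ) (x : EuclideanSpace ℝ (Fin m)) :
    act (c • M) x = c • act M x := by
  simp [act_eq_toEuclideanCLM]

theorem act_sum_left {κ : Type*} (s : Finset κ) (M : κ → Matrix (Fin m) (Fin m) ℝ)
    (x : EuclideanSpace ℝ (Fin m)) : act (∑ i ∈ s, M i) x = ∑ i ∈ s, act (M i) x := by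
  simp [act_eq_toEuclideanCLM, map_sum]

/-- `wordProd` recurses on the last letter; the shift argument for the Lyapunov norm needs to split
off the letter that acts first. -/
theorem wordProd_cons (A : Matrix (Fin m) (Fin m) ℝ) : ∀ (l : ℕ)
    (w : Fin l → Matrix (Fin m) (Fin m) ℝ),
    wordProd (l + 1) (Fin.cons A w) = wordProd l w * A
  | 0, w => by simp [wordProd]
  | l + 1, w => by
      have h := wordProd_cons A l (fun j => w j.castSucc)
      rw [wordProd]
      have h2 : (fun j : Fin (l + 1) => (Fin.cons A w : Fin (l + 2) → _) j.castSucc)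
          = Fin.cons A (fun j : Fin l => w j.castSucc) := by
        funext j
        refine Fin.cases ?_ (fun i => ?_) j
        · rfl
        · rw [← Fin.succ_castSucc]; rfl
      rw [h2, h, ← mul_assoc]
      rfl

theorem act_wordProd_le {p : EuclideanSpace ℝ (Fin m) → ℝ} {η : ℝ} (hη : 0 ≤ η)
    (M : ℕ → Matrix (Fin m) (Fin m) ℝ) (h : ∀ j x, p (act (M j) x) ≤ η * p x) (k : ℕ)
    (x : EuclideanSpace ℝ (Fin m)) :
    p (act (wordProd k (fun j => M j)) x) ≤ η ^ k * p x := by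
  induction k with
  | zero => simp [wordProd, act_one]
  | succ k ih =>
    simp only [wordProd, act_mul]
    refine (h _ _).trans ?_
    rw [pow_succ', mul_assoc]
    exact mul_le_mul_of_nonneg_left ih hη

end Act

/-! ### The quadratic Lyapunov sum of a finite family -/

section Lyapunov

variable {m : ℕ} {ι : Type*}

/-- The largest Euclidean norm of `x` after `l` steps of the switched system with modes `B i`. -/
def growth (B : ι → Matrix (Fin m) (Fin m) ℝ) (l : ℕ) (x : EuclideanSpace ℝ (Fin m)) : ℝ :=
  ⨆ w : Fin l → ι, ‖act (wordProd l (fun j => B (w j))) x‖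

/-- The sum `∑_{l ≤ t} β^{-2l} max_w ‖B_w x‖²` over words `w` of length `l`. -/
def weightedTrunc (B : ι → Matrix (Fin m) (Fin m) ℝ) (β : ℝ) (t : ℕ)
    (x : EuclideanSpace ℝ (Fin m)) : ℝ :=
  ∑ l ∈ Finset.range (t + 1), (β ^ (2 * l))⁻¹ *
    ⨆ w : Fin l → ι, ‖act (wordProd l (fun j => B (w j))) x‖ ^ 2

/-- The square root of the limit of `weightedTrunc`. -/
def weightedNorm (B : ι → Matrix (Fin m) (Fin m) ℝ) (β : ℝ) (x : EuclideanSpace ℝ (Fin m)) : ℝ :=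
  √(limUnder atTop (fun t : ℕ => weightedTrunc B β t x))

variable (B : ι → Matrix (Fin m) (Fin m) ℝ)

theorem le_growth [Finite ι] (l : ℕ) (x : EuclideanSpace ℝ (Fin m)) (w : Fin l → ι) :
    ‖act (wordProd l (fun j => B (w j))) x‖ ≤ growth B l x :=
  le_ciSup (f := fun w : Fin l → ι => ‖act (wordProd l (fun j => B (w j))) x‖)
    (Set.finite_range _).bddAbove w

theorem growth_nonneg (l : ℕ) (x : EuclideanSpace ℝ (Fin m)) : 0 ≤ growth B l x :=
  Real.iSup_nonneg fun _ => norm_nonneg _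

theorem growth_zero (x : EuclideanSpace ℝ (Fin m)) : growth B 0 x = ‖x‖ := by
  simp [growth, wordProd, act_one]

theorem growth_add_le [Finite ι] [Nonempty ι] (l : ℕ) (x y : EuclideanSpace ℝ (Fin m)) :
    growth B l (x + y) ≤ growth B l x + growth B l y := by
  refine ciSup_le fun w => ?_
  rw [act_add_right]
  exact (norm_add_le _ _).trans (add_le_add (le_growth B l x w) (le_growth B l y w))

theorem growth_smul (l : ℕ) (c : ℝ) (x : EuclideanSpace ℝ (Fin m)) :
    growth B l (c • x) = |c| * growth B l x := by
  simp only [growth, act_smul_right, norm_smul, Real.norm_eq_abs]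
  rw [Real.mul_iSup_of_nonneg (abs_nonneg c)]

theorem growth_act_le [Finite ι] [Nonempty ι] (l : ℕ) (i : ι) (x : EuclideanSpace ℝ (Fin m)) :
    growth B l (act (B i) x) ≤ growth B (l + 1) x := by
  refine ciSup_le fun w => ?_
  rw [← act_mul, ← wordProd_cons]
  have h : (Fin.cons (B i) fun j => B (w j)) =
      fun j => B ((Fin.cons i w : Fin (l + 1) → ι) j) := by
    funext j
    refine Fin.cases ?_ (fun i => ?_) j <;> rfl
  rw [h]
  exact le_growth B (l + 1) x (Fin.cons i w)

theorem norm_wordProd_le_maxProdNorm [Finite ι] (l : ℕ) (w : Fin l → ι) :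
    ‖Matrix.toEuclideanCLM (𝕜 := ℝ) (wordProd l (fun j => B (w j)))‖
      ≤ maxProdNorm (Set.range B) l := by
  have : Finite (Set.range B) := (Set.finite_range B).to_subtype
  exact le_ciSup (f := fun w : Fin l → Set.range B =>
    ‖Matrix.toEuclideanCLM (𝕜 := ℝ) (wordProd l (fun j => (w j).1))‖)
    (Set.finite_range _).bddAbove (fun j => ⟨B (w j), w j, rfl⟩)

theorem growth_le [Finite ι] [Nonempty ι] (l : ℕ) (x : EuclideanSpace ℝ (Fin m)) :
    growth B l x ≤ maxProdNorm (Set.range B) l * ‖x‖ := by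
  refine ciSup_le fun w => ?_
  rw [act_eq_toEuclideanCLM]
  exact (ContinuousLinearMap.le_opNorm _ _).trans
    (mul_le_mul_of_nonneg_right (norm_wordProd_le_maxProdNorm B l w) (norm_nonneg _))

theorem maxProdNorm_nonneg (H : Set (Matrix (Fin m) (Fin m) ℝ)) (l : ℕ) : 0 ≤ maxProdNorm H l :=
  Real.iSup_nonneg fun _ => norm_nonneg _

theorem tendsto_jsr_range [Finite ι] [Nonempty ι] :
    Tendsto (fun k : ℕ => maxProdNorm (Set.range B) k ^ (1 / (k : ℝ))) atTop
      (𝓝 (jsr (Set.range B))) := by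
  obtain ⟨C, hC⟩ := (Set.finite_range fun i => ‖Matrix.toEuclideanCLM (𝕜 := ℝ) (B i)‖).bddAbove
  refine tendsto_jsr (Set.range_nonempty B) (B := C) ?_
  rintro _ ⟨i, rfl⟩
  exact hC ⟨i, rfl⟩

theorem jsr_range_nonneg [Finite ι] [Nonempty ι] : 0 ≤ jsr (Set.range B) :=
  ge_of_tendsto' (tendsto_jsr_range B) fun k => Real.rpow_nonneg (maxProdNorm_nonneg _ k) _

/-- For `t` strictly between the joint spectral radius and `β`, the terms are eventually dominated
by a geometric series of ratio `(t / β) ^ 2 < 1`. -/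
theorem summable_maxProdNorm [Finite ι] [Nonempty ι] {β : ℝ} (hβ : jsr (Set.range B) < β) :
    Summable fun l : ℕ => (maxProdNorm (Set.range B) l / β ^ l) ^ 2 := by
  obtain ⟨t, ht, htβ⟩ := exists_between hβ
  have ht0 : 0 < t := (jsr_range_nonneg B).trans_lt ht
  have hβ0 : 0 < β := ht0.trans htβ
  have hg : Summable fun l : ℕ => ((t / β) ^ 2) ^ l := by
    refine summable_geometric_of_lt_one (by positivity) ?_
    exact pow_lt_one₀ (by positivity) ((div_lt_one hβ0).2 htβ) two_ne_zero
  refine Summable.of_norm_bounded_eventually_nat hg ?_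
  filter_upwards [(tendsto_jsr_range B).eventually (gt_mem_nhds ht), eventually_gt_atTop 0]
    with l hl hl0
  have hle : maxProdNorm (Set.range B) l ≤ t ^ l := by
    have := pow_le_pow_left₀ (Real.rpow_nonneg (maxProdNorm_nonneg _ l) _) hl.le l
    rwa [one_div, Real.rpow_inv_natCast_pow (maxProdNorm_nonneg _ l) hl0.ne'] at this
  rw [Real.norm_of_nonneg (sq_nonneg _), ← pow_mul, mul_comm 2 l, pow_mul, div_pow t]
  have := maxProdNorm_nonneg (Set.range B) l
  gcongr

/-- The supremum of squares is the square of the supremum, which exhibits the sum as a squared ℓ²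
norm and makes Minkowski's inequality available. -/
theorem weightedTrunc_eq [Nonempty ι] (β : ℝ) (t : ℕ) (x : EuclideanSpace ℝ (Fin m)) :
    weightedTrunc B β t x = ∑ l ∈ Finset.range (t + 1), (growth B l x / β ^ l) ^ 2 := by
  refine Finset.sum_congr rfl fun l _ => ?_
  rw [← Real.iSup_pow fun _ => norm_nonneg _, div_pow, ← pow_mul, mul_comm l 2, div_eq_inv_mul]
  rfl

variable [Finite ι] [Nonempty ι] {β : ℝ}

theorem growth_div_sq_le (hβ : 0 < β) (l : ℕ) (x : EuclideanSpace ℝ (Fin m)) :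
    (growth B l x / β ^ l) ^ 2 ≤ (maxProdNorm (Set.range B) l / β ^ l) ^ 2 * ‖x‖ ^ 2 := by
  rw [← mul_pow, div_mul_eq_mul_div]
  have := growth_nonneg B l x
  have := growth_le B l x
  gcongr

theorem summable_growth (hβ : jsr (Set.range B) < β) (x : EuclideanSpace ℝ (Fin m)) :
    Summable fun l : ℕ => (growth B l x / β ^ l) ^ 2 :=
  Summable.of_nonneg_of_le (fun _ => sq_nonneg _)
    (fun l => growth_div_sq_le B ((jsr_range_nonneg B).trans_lt hβ) l x)
    ((summable_maxProdNorm B hβ).mul_right _)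

theorem tendsto_weightedTrunc_tsum (hβ : jsr (Set.range B) < β) (x : EuclideanSpace ℝ (Fin m)) :
    Tendsto (fun t => weightedTrunc B β t x) atTop
      (𝓝 (∑' l : ℕ, (growth B l x / β ^ l) ^ 2)) := by
  simp only [weightedTrunc_eq]
  exact (tendsto_add_atTop_iff_nat 1).2 (summable_growth B hβ x).hasSum.tendsto_sum_nat

theorem tendsto_weightedTrunc (hβ : jsr (Set.range B) < β) (x : EuclideanSpace ℝ (Fin m)) :
    Tendsto (fun t => weightedTrunc B β t x) atTop
      (𝓝 (limUnder atTop (fun t : ℕ => weightedTrunc B β t x))) :=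
  tendsto_nhds_limUnder ⟨_, tendsto_weightedTrunc_tsum B hβ x⟩

theorem weightedNorm_eq (hβ : jsr (Set.range B) < β) (x : EuclideanSpace ℝ (Fin m)) :
    weightedNorm B β x = √(∑' l : ℕ, (growth B l x / β ^ l) ^ 2) := by
  rw [weightedNorm, (tendsto_weightedTrunc_tsum B hβ x).limUnder_eq]

theorem tendsto_sqrt_sum (hβ : jsr (Set.range B) < β) (x : EuclideanSpace ℝ (Fin m)) :
    Tendsto (fun t => √(∑ l ∈ Finset.range t, (growth B l x / β ^ l) ^ 2)) atTop
      (𝓝 (weightedNorm B β x)) := by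
  rw [weightedNorm_eq B hβ]
  exact (Real.continuous_sqrt.tendsto _).comp (summable_growth B hβ x).hasSum.tendsto_sum_nat

theorem norm_le_weightedNorm (hβ : jsr (Set.range B) < β) (x : EuclideanSpace ℝ (Fin m)) :
    ‖x‖ ≤ weightedNorm B β x := by
  rw [weightedNorm_eq B hβ]
  refine Real.le_sqrt_of_sq_le ?_
  have := (summable_growth B hβ x).le_tsum 0 fun _ _ => sq_nonneg _
  simpa [growth_zero] using this

theorem exists_weightedNorm_le (hβ : jsr (Set.range B) < β) :
    ∃ K : ℝ, 1 ≤ K ∧ ∀ x, weightedNorm B β x ≤ K * ‖x‖ := by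
  refine ⟨max 1 √(∑' l : ℕ, (maxProdNorm (Set.range B) l / β ^ l) ^ 2), le_max_left _ _,
    fun x => ?_⟩
  refine le_trans ?_ (mul_le_mul_of_nonneg_right (le_max_right _ _) (norm_nonneg x))
  conv_rhs => rw [← Real.sqrt_sq (norm_nonneg x)]
  rw [weightedNorm_eq B hβ, ← Real.sqrt_mul' _ (sq_nonneg _), ← tsum_mul_right]
  exact Real.sqrt_le_sqrt ((summable_growth B hβ x).tsum_le_tsum
    (fun l => growth_div_sq_le B ((jsr_range_nonneg B).trans_lt hβ) l x)
    ((summable_maxProdNorm B hβ).mul_right _))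

/-- Minkowski's inequality for the square roots of finite sums of squares. -/
theorem sqrt_sum_sq_add_le {κ : Type*} (s : Finset κ) (f g : κ → ℝ) :
    √(∑ i ∈ s, (f i + g i) ^ 2) ≤ √(∑ i ∈ s, f i ^ 2) + √(∑ i ∈ s, g i ^ 2) := by
  have h := Real.Lp_add_le s f g (p := 2) one_le_two
  simpa [Real.sqrt_eq_rpow] using h

theorem isNorm_weightedNorm (hβ : jsr (Set.range B) < β) : IsNorm (weightedNorm B β) where
  nonneg x := Real.sqrt_nonneg _
  eq_zero_iff x := by
    constructor
    · intro h
      exact norm_le_zero_iff.1 (h ▸ norm_le_weightedNorm B hβ x)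
    · rintro rfl
      obtain ⟨K, -, hK⟩ := exists_weightedNorm_le B hβ
      exact le_antisymm (by simpa using hK 0) (Real.sqrt_nonneg _)
  smul c x := by
    rw [weightedNorm_eq B hβ, weightedNorm_eq B hβ]
    simp only [growth_smul, mul_div_assoc, mul_pow]
    rw [tsum_mul_left, Real.sqrt_mul (sq_nonneg _), Real.sqrt_sq (abs_nonneg c)]
  add_le x y := by
    have hβ0 : 0 < β := (jsr_range_nonneg B).trans_lt hβ
    -- Minkowski is applied to the partial sums, and the inequality survives the limit.
    refine le_of_tendsto_of_tendsto' (tendsto_sqrt_sum B hβ (x + y))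
      ((tendsto_sqrt_sum B hβ x).add (tendsto_sqrt_sum B hβ y)) fun t => ?_
    refine le_trans (Real.sqrt_le_sqrt (Finset.sum_le_sum fun l _ => ?_))
      (sqrt_sum_sq_add_le _ _ _)
    rw [← add_div]
    have := growth_nonneg B l (x + y)
    have := growth_add_le B l x y
    gcongr

/-- By `growth_act_le`, the `l`-th term at `act (B i) x` is at most `β ^ 2` times the `(l + 1)`-st
term at `x`; the term `l = 0` at `x` is dropped. -/
theorem weightedNorm_act_le (hβ : jsr (Set.range B) < β) (i : ι)
    (x : EuclideanSpace ℝ (Fin m)) :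
    weightedNorm B β (act (B i) x) ≤ β * weightedNorm B β x := by
  have hβ0 : 0 < β := (jsr_range_nonneg B).trans_lt hβ
  rw [weightedNorm_eq B hβ, weightedNorm_eq B hβ]
  nth_rewrite 2 [← Real.sqrt_sq hβ0.le]
  rw [← Real.sqrt_mul (sq_nonneg _)]
  refine Real.sqrt_le_sqrt ?_
  have hs := summable_growth B hβ x
  rw [hs.tsum_eq_zero_add, mul_add, ← tsum_mul_left]
  refine le_trans ?_ (le_add_of_nonneg_left (by positivity))
  refine (summable_growth B hβ _).tsum_le_tsum (fun l => ?_)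
    (((summable_nat_add_iff 1).2 hs).mul_left _)
  have h1 : β ^ 2 * (growth B (l + 1) x / β ^ (l + 1)) ^ 2 = (growth B (l + 1) x / β ^ l) ^ 2 := by
    rw [← mul_pow, pow_succ β l, ← mul_div_assoc, mul_comm β, mul_div_mul_right _ _ hβ0.ne']
  rw [h1]
  have := growth_nonneg B l (act (B i) x)
  have := growth_act_le B l i x
  gcongr

theorem weightedNorm_act_le_of_mem_convexHull (hβ : jsr (Set.range B) < β)
    {M : Matrix (Fin m) (Fin m) ℝ} (hM : M ∈ convexHull ℝ (Set.range B))
    (x : EuclideanSpace ℝ (Fin m)) :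
    weightedNorm B β (act M x) ≤ β * weightedNorm B β x := by
  have hp := isNorm_weightedNorm B hβ
  suffices h : convexHull ℝ (Set.range B) ⊆
      {M | weightedNorm B β (act M x) ≤ β * weightedNorm B β x} from h hM
  refine convexHull_min ?_ ?_
  · rintro _ ⟨i, rfl⟩
    exact weightedNorm_act_le B hβ i x
  · intro M hM N hN a b ha hb hab
    simp only [Set.mem_ofPred_eq] at hM hN ⊢
    rw [act_add_left, act_smul_left, act_smul_left]
    refine (hp.add_le _ _).trans ?_
    rw [hp.smul, hp.smul, abs_of_nonneg ha, abs_of_nonneg hb]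
    calc _ ≤ a * (β * weightedNorm B β x) + b * (β * weightedNorm B β x) := by gcongr
      _ = _ := by rw [← add_mul, hab, one_mul]

theorem uniformlyExponentiallyStable_convexHull (h : jsr (Set.range B) < 1) :
    UniformlyExponentiallyStable (convexHull ℝ (Set.range B)) := by
  obtain ⟨β, hβ, hβ1⟩ := exists_between h
  have hβ0 : 0 < β := (jsr_range_nonneg B).trans_lt hβ
  obtain ⟨K, hK1, hK⟩ := exists_weightedNorm_le B hβ
  refine ⟨K, hK1, β, hβ0, hβ1, fun M hM k x => ?_⟩
  calc _ ≤ weightedNorm B β (act (wordProd k (fun j => M j)) x) := norm_le_weightedNorm B hβ _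
    _ ≤ β ^ k * weightedNorm B β x := act_wordProd_le hβ0.le M
        (fun j x => weightedNorm_act_le_of_mem_convexHull B hβ (hM j) x) k x
    _ ≤ β ^ k * (K * ‖x‖) := by gcongr; exact hK x
    _ = _ := by ring

end Lyapunov

/-! ### Norms in finite dimension -/

section Norms

variable {m : ℕ} {p : EuclideanSpace ℝ (Fin m) → ℝ}

theorem IsNorm.neg {E : Type*} [AddCommGroup E] [Module ℝ E] {p : E → ℝ} (hp : IsNorm p) (x : E) :
    p (-x) = p x := by
  simpa using hp.smul (-1) x

theorem IsNorm.sub_comm {E : Type*} [AddCommGroup E] [Module ℝ E] {p : E → ℝ} (hp : IsNorm p)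
    (x y : E) : p (x - y) = p (y - x) := by
  rw [← hp.neg, neg_sub]

theorem IsNorm.sum_le {E : Type*} [AddCommGroup E] [Module ℝ E] {p : E → ℝ} (hp : IsNorm p)
    {κ : Type*} (s : Finset κ) (f : κ → E) : p (∑ i ∈ s, f i) ≤ ∑ i ∈ s, p (f i) :=
  Finset.le_sum_of_subadditive p ((hp.eq_zero_iff 0).2 rfl).le hp.add_le s f

theorem IsNorm.continuous (hp : IsNorm p) {K : ℝ} (hK : ∀ x, p x ≤ K * ‖x‖) : Continuous p := by
  refine (LipschitzWith.of_le_add_mul' K fun x y => ?_).continuous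
  have := hp.add_le (x - y) y
  rw [sub_add_cancel] at this
  rw [dist_eq_norm]
  linarith [hK (x - y)]

open MeasureTheory Pointwise in
/-- A set of more than `(1 + 2/δ)^m` points in the unit ball of a norm on `ℝ^m` has two points
at distance less than `δ`, whatever the norm. -/
theorem IsNorm.exists_dist_lt (hp : IsNorm p) {K : ℝ} (hK : ∀ x, p x ≤ K * ‖x‖)
    (hle : ∀ x, ‖x‖ ≤ p x) {δ : ℝ} (hδ : 0 < δ) {N : ℕ} (hN : (1 + 2 / δ) ^ m < N)
    (y : ℕ → EuclideanSpace ℝ (Fin m)) (hy : ∀ i < N, p (y i) ≤ 1) :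
    ∃ i j, i < j ∧ j < N ∧ p (y j - y i) < δ := by
  by_contra! hsep
  have hsep' : ∀ i < N, ∀ j < N, i ≠ j → δ ≤ p (y i - y j) := by
    intro i hi j hj hij
    rcases lt_or_gt_of_ne hij with h | h
    · rw [hp.sub_comm]; exact hsep i j h hj
    · exact hsep j i h hi
  set U : Set (EuclideanSpace ℝ (Fin m)) := {x | p x < δ / 2} with hU
  have hUo : IsOpen U := isOpen_lt (hp.continuous hK) continuous_const
  have hU0 : (0 : EuclideanSpace ℝ (Fin m)) ∈ U := by
    simp only [hU, Set.mem_ofPred_eq, (hp.eq_zero_iff 0).2 rfl]; positivity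
  have hpos : volume U ≠ 0 := (hUo.measure_pos volume ⟨0, hU0⟩).ne'
  have hfin : volume U ≠ ⊤ := by
    refine ((measure_mono (t := Metric.ball 0 (δ / 2)) fun x hx => ?_).trans_lt
      Metric.isBounded_ball.measure_lt_top).ne
    simpa using (hle x).trans_lt hx
  have hdisj : ((Finset.range N : Finset ℕ) : Set ℕ).PairwiseDisjoint
      fun i => (fun x => x + -y i) ⁻¹' U := by
    intro i hi j hj hij
    refine Set.disjoint_left.2 fun x hx hx' => ?_
    have h := hsep' i (by simpa using hi) j (by simpa using hj) hij
    have h1 := hp.add_le (x + -y j) (-(x + -y i))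
    rw [hp.neg, show x + -y j + -(x + -y i) = y i - y j by abel] at h1
    have h2 : p (x + -y i) < δ / 2 := hx
    have h3 : p (x + -y j) < δ / 2 := hx'
    linarith
  -- The points have norm at most `1`, so the balls of radius `δ / 2` around them lie in the ball of
  -- radius `1 + δ / 2 = (1 + 2 / δ) * (δ / 2)`.
  have hsub : (⋃ i ∈ Finset.range N, (fun x => x + -y i) ⁻¹' U) ⊆ (1 + 2 / δ) • U := by
    intro x hx
    simp only [Set.mem_iUnion, Finset.mem_range] at hx
    obtain ⟨i, hi, hx⟩ := hx
    have hc : (0 : ℝ) < 1 + 2 / δ := by positivity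
    rw [Set.mem_smul_set_iff_inv_smul_mem₀ hc.ne']
    change p _ < δ / 2
    rw [hp.smul, abs_of_pos (inv_pos.2 hc), inv_mul_lt_iff₀ hc]
    have h1 : p (x + -y i) < δ / 2 := hx
    have h2 := hp.add_le (x + -y i) (y i)
    rw [neg_add_cancel_right] at h2
    have h3 : (1 + 2 / δ) * (δ / 2) = δ / 2 + 1 := by field_simp
    linarith [hy i hi]
  -- Comparing volumes of the disjoint translates gives `N ≤ (1 + 2 / δ) ^ m`; the volume of `U`
  -- cancels, so the shape of the norm plays no role.
  have hmeas := measure_mono (μ := volume) hsub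
  rw [measure_biUnion_finset hdisj
    fun i _ => (hUo.preimage (continuous_id.add continuous_const)).measurableSet,
    Measure.addHaar_smul] at hmeas
  simp only [measure_preimage_add_right, Finset.sum_const, Finset.card_range, nsmul_eq_mul,
    finrank_euclideanSpace, Fintype.card_fin] at hmeas
  have h := (ENNReal.mul_le_mul_iff_left hpos hfin).1 hmeas
  rw [abs_of_nonneg (by positivity), ← ENNReal.ofReal_natCast,
    ENNReal.ofReal_le_ofReal_iff (by positivity)] at h
  linarith

end Norms

/-! ### Almost fixed vectors of contractions -/

section Spectral

variable {m : ℕ}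

/-- The value at `1` is the product of the `m` factors `1 - z` over the complex roots, each of
modulus at least `1 - r`. -/
theorem norm_charpoly_eval_one_ge (P : Matrix (Fin m) (Fin m) ℝ) {r : ℝ} (hr1 : r ≤ 1)
    (hr : ∀ z ∈ (P.charpoly.map Complex.ofRealHom).roots, ‖z‖ ≤ r) :
    (1 - r) ^ m ≤ |P.charpoly.eval 1| := by
  have hs := IsAlgClosed.splits (P.charpoly.map Complex.ofRealHom)
  have hm : (P.charpoly.map Complex.ofRealHom).Monic := P.charpoly_monic.map _
  have hcard : (P.charpoly.map Complex.ofRealHom).roots.card = m := by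
    rw [← hs.natDegree_eq_card_roots, P.charpoly_monic.natDegree_map, Matrix.charpoly_natDegree_eq_dim,
      Fintype.card_fin]
  have he : ‖(P.charpoly.map Complex.ofRealHom).eval 1‖ = |P.charpoly.eval 1| := by
    rw [Polynomial.eval_map, ← map_one Complex.ofRealHom, Polynomial.eval₂_at_apply]
    simp
  rw [← he, hs.eval_eq_prod_roots_of_monic hm]
  have key : ∀ s : Multiset ℂ, (∀ z ∈ s, ‖z‖ ≤ r) →
      (1 - r) ^ s.card ≤ ‖(s.map fun z => 1 - z).prod‖ := by
    intro s
    induction s using Multiset.induction_on with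
    | empty => simp
    | cons a s ih =>
      intro h
      rw [Multiset.card_cons, Multiset.map_cons, Multiset.prod_cons, norm_mul, pow_succ']
      refine mul_le_mul ?_ (ih fun z hz => h z (Multiset.mem_cons_of_mem hz))
        (pow_nonneg (by linarith) _) (norm_nonneg _)
      have h1 := norm_sub_norm_le (1 : ℂ) a
      rw [norm_one] at h1
      linarith [h a (Multiset.mem_cons_self a s)]
  simpa [hcard] using key _ hr

theorem abs_charpoly_coeff_le (P : Matrix (Fin m) (Fin m) ℝ)
    (hr : ∀ z ∈ (P.charpoly.map Complex.ofRealHom).roots, ‖z‖ ≤ 1) (j : ℕ) :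
    |P.charpoly.coeff j| ≤ 2 ^ m := by
  have h := Polynomial.coeff_le_of_roots_le j P.charpoly_monic
    (IsAlgClosed.splits (P.charpoly.map Complex.ofRealHom)) hr
  rw [Polynomial.coeff_map, one_pow, one_mul, Matrix.charpoly_natDegree_eq_dim,
    Fintype.card_fin] at h
  refine le_trans (by simpa using h) ?_
  exact_mod_cast Nat.choose_le_two_pow m j

/-- Telescoping: `x - P ^ (j + 1) x = (x - P x) + P (x - P ^ j x)`, and `P` does not increase `p`.
-/
theorem IsNorm.sub_act_pow_le {p : EuclideanSpace ℝ (Fin m) → ℝ} (hp : IsNorm p)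
    (P : Matrix (Fin m) (Fin m) ℝ) (hP : ∀ x, p (act P x) ≤ p x) (x : EuclideanSpace ℝ (Fin m))
    (j : ℕ) : p (x - act (P ^ j) x) ≤ j * p (x - act P x) := by
  induction j with
  | zero => simp [act_one, (hp.eq_zero_iff 0).2 rfl]
  | succ j ih =>
    have h := hp.add_le (x - act P x) (act P (x - act (P ^ j) x))
    rw [act_sub_right, sub_add_sub_cancel, ← act_mul, ← pow_succ'] at h
    have h2 := hP (x - act (P ^ j) x)
    rw [act_sub_right, ← act_mul, ← pow_succ'] at h2
    push_cast
    linarith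

/-- If the eigenvalues of a contraction have modulus at most `r < 1`, a bound for
`‖(1 - P)⁻¹‖` depends on `r` and the dimension, but not on the norm. -/
theorem IsNorm.le_sub_act {p : EuclideanSpace ℝ (Fin m) → ℝ} (hp : IsNorm p)
    (P : Matrix (Fin m) (Fin m) ℝ) (hP : ∀ x, p (act P x) ≤ p x) {r : ℝ} (hr1 : r ≤ 1)
    (hr : ∀ z ∈ (P.charpoly.map Complex.ofRealHom).roots, ‖z‖ ≤ r)
    (x : EuclideanSpace ℝ (Fin m)) :
    (1 - r) ^ m * p x ≤ (m + 1) * (2 ^ m * m) * p (x - act P x) := by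
  have hCH := Matrix.aeval_self_charpoly P
  have hdeg : P.charpoly.natDegree = m := by
    rw [Matrix.charpoly_natDegree_eq_dim, Fintype.card_fin]
  rw [Polynomial.aeval_eq_sum_range, hdeg] at hCH
  have h0 : ∑ j ∈ Finset.range (m + 1), P.charpoly.coeff j • act (P ^ j) x = 0 := by
    simp only [← act_smul_left]
    rw [← act_sum_left, hCH]
    simp [act_eq_toEuclideanCLM]
  -- With `χ` the characteristic polynomial, Cayley–Hamilton gives `χ(1) x = χ(1) x - χ(P) x`, a
  -- combination of the differences `x - P ^ j x`.
  have h1 : P.charpoly.eval 1 • x =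
      ∑ j ∈ Finset.range (m + 1), P.charpoly.coeff j • (x - act (P ^ j) x) := by
    simp only [smul_sub, Finset.sum_sub_distrib, h0, sub_zero]
    rw [← Finset.sum_smul, Polynomial.eval_eq_sum_range, hdeg]
    simp
  calc (1 - r) ^ m * p x ≤ |P.charpoly.eval 1| * p x :=
        mul_le_mul_of_nonneg_right (norm_charpoly_eval_one_ge P hr1 hr) (hp.nonneg x)
    _ = p (∑ j ∈ Finset.range (m + 1), P.charpoly.coeff j • (x - act (P ^ j) x)) := by
        rw [← hp.smul, h1]
    _ ≤ ∑ j ∈ Finset.range (m + 1), p (P.charpoly.coeff j • (x - act (P ^ j) x)) :=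
        hp.sum_le _ _
    _ ≤ ∑ j ∈ Finset.range (m + 1), 2 ^ m * m * p (x - act P x) := by
        refine Finset.sum_le_sum fun j hj => ?_
        rw [hp.smul, mul_assoc]
        refine mul_le_mul (abs_charpoly_coeff_le P (fun z hz => (hr z hz).trans hr1) j) ?_
          (hp.nonneg _) (by positivity)
        refine (hp.sub_act_pow_le P hP x j).trans
          (mul_le_mul_of_nonneg_right ?_ (hp.nonneg _))
        exact_mod_cast Nat.lt_succ_iff.1 (Finset.mem_range.1 hj)
    _ = _ := by simp; ring

/-- If `(c P)^n → 0` strongly, the complex eigenvalues `z` of `P` satisfy `c ‖z‖ < 1`. -/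
theorem norm_root_charpoly_lt (P : Matrix (Fin m) (Fin m) ℝ) {c : ℝ} (hc : 0 < c)
    (h : ∀ x, Tendsto (fun n : ℕ => act ((c • P) ^ n) x) atTop (𝓝 0)) {z : ℂ}
    (hz : z ∈ (P.charpoly.map Complex.ofRealHom).roots) : c * ‖z‖ < 1 := by
  set Q : Matrix (Fin m) (Fin m) ℂ := (c • P).map Complex.ofRealHom with hQ
  have hroot := (Polynomial.mem_roots'.1 hz).2
  rw [← Matrix.charpoly_map, Polynomial.IsRoot.def, Matrix.eval_charpoly] at hroot
  obtain ⟨v, hv0, hv⟩ := Matrix.exists_mulVec_eq_zero_iff.2 hroot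
  have hPv : (P.map Complex.ofRealHom).mulVec v = z • v := by
    rw [Matrix.sub_mulVec, sub_eq_zero] at hv
    rw [← hv]
    simp [Matrix.scalar_apply]
  have hQv : Q.mulVec v = ((c : ℂ) * z) • v := by
    have : Q = (c : ℂ) • P.map Complex.ofRealHom := by
      ext i j; simp [hQ]
    rw [this, Matrix.smul_mulVec, hPv, smul_smul]
  have hpow : ∀ n : ℕ, (Q ^ n).mulVec v = ((c : ℂ) * z) ^ n • v := by
    intro n
    induction n with
    | zero => simp
    | succ n ih =>
      rw [pow_succ, ← Matrix.mulVec_mulVec, hQv, Matrix.mulVec_smul, ih, smul_smul, pow_succ']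
  -- Convergence is assumed on real vectors only; testing the standard basis gives it entrywise,
  -- hence on the complex eigenvector `v`.
  have hentry : ∀ i j, Tendsto (fun n : ℕ => (Q ^ n) i j) atTop (𝓝 0) := by
    intro i j
    have h1 := ((EuclideanSpace.proj (𝕜 := ℝ) i).continuous.tendsto _).comp
      (h (EuclideanSpace.single j 1))
    have h2 := (Complex.continuous_ofReal.tendsto _).comp h1
    simp only [map_zero, Complex.ofReal_zero] at h2
    refine h2.congr fun n => ?_
    have h3 : Q ^ n = ((c • P) ^ n).map Complex.ofRealHom := by
      rw [hQ, Matrix.map_pow]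
    rw [h3]
    simp [act]
  obtain ⟨i, hi⟩ := Function.ne_iff.1 hv0
  have hlim : Tendsto (fun n : ℕ => ((c : ℂ) * z) ^ n * v i) atTop (𝓝 0) := by
    have h1 : Tendsto (fun n : ℕ => ∑ j, (Q ^ n) i j * v j) atTop (𝓝 (∑ j, 0 * v j)) :=
      tendsto_finsetSum _ fun j _ => (hentry i j).mul_const _
    simp only [zero_mul, Finset.sum_const_zero] at h1
    refine h1.congr fun n => ?_
    exact congrFun (hpow n) i
  have hlim2 := (hlim.div_const (v i)).norm
  simp only [mul_div_cancel_right₀ _ (show v i ≠ 0 from hi), zero_div, norm_zero, norm_pow,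
    norm_mul, Complex.norm_real, Real.norm_of_nonneg hc.le] at hlim2
  have := tendsto_pow_atTop_nhds_zero_iff.1 hlim2
  rwa [abs_of_nonneg (by positivity)] at this

end Spectral

/-! ### Periodic switching -/

section Periodic

variable {m : ℕ}

theorem wordProd_add_seq (M : ℕ → Matrix (Fin m) (Fin m) ℝ) (a b : ℕ) :
    wordProd (a + b) (fun j => M j) =
      wordProd b (fun j => M (a + j)) * wordProd a (fun j => M j) :=
  wordProd_add b fun j => M j

theorem wordProd_mul_of_periodic {M : ℕ → Matrix (Fin m) (Fin m) ℝ} {k : ℕ}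
    (hM : Function.Periodic M k) (n : ℕ) :
    wordProd (k * n) (fun j => M j) = wordProd k (fun j => M j) ^ n := by
  induction n with
  | zero => simp [wordProd]
  | succ n ih =>
    rw [mul_add_one, wordProd_add_seq, ih, pow_succ']
    congr 2
    funext j
    rw [add_comm, mul_comm]
    exact hM.nat_mul n j

/-- If every trajectory under periodic switching converges to `0`, so do the powers of every
nonempty product. -/
theorem tendsto_act_pow_wordProd {H : Set (Matrix (Fin m) (Fin m) ℝ)}
    (h : ∀ M : ℕ → Matrix (Fin m) (Fin m) ℝ, (∀ k, M k ∈ H) →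
      (∃ l : ℕ, 0 < l ∧ Function.Periodic M l) → ∀ x, IsTrajectory M x → Tendsto x atTop (𝓝 0))
    (M : ℕ → Matrix (Fin m) (Fin m) ℝ) (hM : ∀ k, M k ∈ H) {k : ℕ} (hk : 0 < k)
    (x : EuclideanSpace ℝ (Fin m)) :
    Tendsto (fun n : ℕ => act (wordProd k (fun j => M j) ^ n) x) atTop (𝓝 0) := by
  -- The first `k` letters are repeated periodically; the trajectory sampled at multiples of `k`
  -- consists of the powers of the product.
  have hper : Function.Periodic (fun j => M (j % k)) k := fun j => by simp
  have hlim := h (fun j => M (j % k)) (fun j => hM _) ⟨k, hk, hper⟩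
    (fun n => act (wordProd n (fun j => M (j % k))) x)
    (fun n => by simp [wordProd, act_mul])
  refine (hlim.comp (tendsto_id.const_mul_atTop' hk)).congr fun n => ?_
  have := wordProd_mul_of_periodic hper n
  simp only [Function.comp_apply, id_eq, this]
  congr 3
  funext j
  rw [Nat.mod_eq_of_lt j.2]

end Periodic

/-! ### Instability -/

section Instability

variable {m : ℕ} {ι : Type*} (B : ι → Matrix (Fin m) (Fin m) ℝ)
  {p : EuclideanSpace ℝ (Fin m) → ℝ}

theorem maxProdNorm_range_le [Nonempty ι] {n : ℕ} {C : ℝ} (hC : 0 ≤ C)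
    (h : ∀ (u : ℕ → ι) x, ‖act (wordProd n (fun j => B (u j))) x‖ ≤ C * ‖x‖) :
    maxProdNorm (Set.range B) n ≤ C := by
  have : Nonempty (Set.range B) := (Set.range_nonempty B).to_subtype
  refine ciSup_le fun w => ContinuousLinearMap.opNorm_le_bound _ hC fun x => ?_
  choose v hv using fun j => (w j).2
  set u : ℕ → ι := fun i => if hi : i < n then v ⟨i, hi⟩ else Classical.arbitrary ι with hu
  have hw : (fun j => (w j).1) = fun j : Fin n => B (u j) := by
    funext j
    rw [← hv j]
    simp [hu]
  rw [hw]
  exact h u x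

/-- A norm cannot shrink every product of length `N` by more than `ρ^N` allows. -/
theorem exists_lt_act_wordProd [Finite ι] [Nonempty ι] {K : ℝ} (hK0 : 0 < K)
    (hK : ∀ x, p x ≤ K * ‖x‖)
    (hle : ∀ x, ‖x‖ ≤ p x) {N : ℕ} (hN : 0 < N) {c : ℝ} (hc : 0 < c)
    (hcρ : c < jsr (Set.range B) ^ N) :
    ∃ (u : ℕ → ι) (x : EuclideanSpace ℝ (Fin m)),
      c * p x < p (act (wordProd N (fun j => B (u j))) x) := by
  by_contra! hcon
  -- If every block of length `N` contracted by `c`, then `k` consecutive blocks would contract by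
  -- `c ^ k`, making the joint spectral radius at most `c ^ (1 / N)`.
  have hpow : ∀ (k : ℕ) (u : ℕ → ι) x,
      p (act (wordProd (N * k) (fun j => B (u j))) x) ≤ c ^ k * p x := by
    intro k
    induction k with
    | zero => intro u x; simp [wordProd, act_one]
    | succ k ih =>
      intro u x
      have h := wordProd_add_seq (fun j => B (u j)) (N * k) N
      rw [mul_add_one, h, act_mul, pow_succ', mul_assoc]
      exact (hcon (fun j => u (N * k + j)) _).trans
        (mul_le_mul_of_nonneg_left (ih u x) hc.le)
  have hmax : ∀ k, maxProdNorm (Set.range B) (N * k) ≤ c ^ k * K := fun k =>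
    maxProdNorm_range_le B (by positivity) fun u x => by
      rw [mul_assoc]
      exact (hle _).trans ((hpow k u x).trans (by gcongr; exact hK x))
  have hroot : c ^ (1 / (N : ℝ)) < jsr (Set.range B) := by
    rw [one_div]
    exact (Real.rpow_inv_lt_iff_of_pos hc.le (jsr_range_nonneg B) (by exact_mod_cast hN)).2
      (by rwa [Real.rpow_natCast])
  obtain ⟨s, hs, hsρ⟩ := exists_between hroot
  have hs0 : 0 < s := (Real.rpow_pos_of_pos hc _).trans hs
  have hcs : c < s ^ N := by
    rw [one_div, Real.rpow_inv_lt_iff_of_pos hc.le hs0.le (by exact_mod_cast hN),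
      Real.rpow_natCast] at hs
    exact hs
  -- `s ^ (N * k) ≤ maxProdNorm ≤ c ^ k * K` for large `k`, although `s ^ N / c > 1`.
  have hev : ∀ᶠ k : ℕ in atTop, (s ^ N / c) ^ k ≤ K := by
    have h1 := (tendsto_jsr_range B).eventually (lt_mem_nhds hsρ)
    have h2 : Tendsto (fun k : ℕ => N * k) atTop atTop := tendsto_id.const_mul_atTop' hN
    filter_upwards [h2.eventually h1, eventually_gt_atTop 0] with k hk hk0
    have h3 := pow_le_pow_left₀ hs0.le hk.le (N * k)
    rw [one_div, Real.rpow_inv_natCast_pow (maxProdNorm_nonneg _ _)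
      (Nat.mul_pos hN hk0).ne'] at h3
    rw [div_pow, div_le_iff₀ (by positivity), ← pow_mul, mul_comm K]
    exact h3.trans (hmax k)
  have htop := (tendsto_pow_atTop_atTop_of_one_lt ((one_lt_div hc).2 hcs)).eventually_gt_atTop K
  obtain ⟨k, h1, h2⟩ := (hev.and htop).exists
  linarith

/-- A trajectory of length `N` that almost realizes the growth rate `t` of the norm `p` nearly
returns, up to scaling, to one of its points. -/
theorem IsNorm.exists_almost_fixed (hp : IsNorm p) {K : ℝ} (hK : ∀ x, p x ≤ K * ‖x‖)
    (hle : ∀ x, ‖x‖ ≤ p x) {t : ℝ} (ht0 : 0 < t) {δ : ℝ} (hδ0 : 0 < δ) {N : ℕ}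
    (hN : (1 + 2 / δ) ^ m < N) (M : ℕ → Matrix (Fin m) (Fin m) ℝ)
    (hM : ∀ j z, p (act (M j) z) ≤ t * p z) {x : EuclideanSpace ℝ (Fin m)}
    (hx : t ^ N / 2 * p x < p (act (wordProd N (fun j => M j)) x)) :
    ∃ i k, 0 < k ∧ ∃ z, 1 / 2 ≤ p z ∧
      p (act ((t ^ k)⁻¹ • wordProd k (fun j => M (i + j))) z - z) < δ := by
  have hwordle : ∀ i k z, p (act (wordProd k (fun j => M (i + j))) z) ≤ t ^ k * p z :=
    fun i k z => act_wordProd_le ht0.le (fun j => M (i + j)) (fun j => hM (i + j)) k z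
  have hwordle' : ∀ k z, p (act (wordProd k (fun j => M j)) z) ≤ t ^ k * p z :=
    fun k z => act_wordProd_le ht0.le M hM k z
  have hx0 : 0 < p x := by
    refine (hp.nonneg x).lt_of_ne fun h0 => ?_
    have := hwordle' N x
    rw [← h0] at this hx
    linarith
  have htk : ∀ k, 0 < t ^ k * p x := fun k => mul_pos (pow_pos ht0 k) hx0
  obtain ⟨y, hy⟩ : ∃ y : ℕ → EuclideanSpace ℝ (Fin m),
      ∀ k, y k = (t ^ k * p x)⁻¹ • act (wordProd k (fun j => M j)) x := ⟨_, fun _ => rfl⟩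
  have hpy : ∀ k, p (y k) = (t ^ k * p x)⁻¹ * p (act (wordProd k (fun j => M j)) x) :=
    fun k => by rw [hy, hp.smul, abs_of_pos (inv_pos.2 (htk k))]
  have hy1 : ∀ k, p (y k) ≤ 1 := fun k => by
    rw [hpy, inv_mul_le_one₀ (htk k)]
    exact hwordle' k x
  obtain ⟨i, j, hij, hjN, hlt⟩ := hp.exists_dist_lt hK hle hδ0 hN y fun i _ => hy1 i
  obtain ⟨k, rfl⟩ := Nat.exists_eq_add_of_le hij.le
  refine ⟨i, k, by omega, y i, ?_, ?_⟩
  -- The `q = N - i` letters still to come stretch by at most `t ^ q`, so the loss of the factor `2`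
  -- over the whole word forces `p (y i) ≥ 1 / 2`.
  · obtain ⟨q, rfl⟩ := Nat.exists_eq_add_of_le (hij.le.trans hjN.le)
    have h1 := hwordle i q (act (wordProd i (fun j => M j)) x)
    rw [← act_mul, ← wordProd_add_seq M] at h1
    have h2 := hx.le.trans h1
    rw [hpy, inv_mul_eq_div, le_div_iff₀ (htk i)]
    have h3 : t ^ q * (1 / 2 * (t ^ i * p x)) ≤
        t ^ q * p (act (wordProd i (fun j => M j)) x) := by
      refine le_trans (le_of_eq ?_) h2
      ring
    exact le_of_mul_le_mul_left h3 (pow_pos ht0 q)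
  · have hyk : y (i + k) = act ((t ^ k)⁻¹ • wordProd k (fun j => M (i + j))) (y i) := by
      rw [hy, hy, wordProd_add_seq M, act_mul, act_smul_left, act_smul_right, smul_smul, pow_add,
        ← mul_inv]
      congr 2
      ring
    rwa [← hyk]

/-- If the joint spectral radius exceeds `1`, some periodic switching sequence has a trajectory
that does not converge to `0`. -/
theorem exists_periodic_not_tendsto [Finite ι] [Nonempty ι] (hρ : 1 < jsr (Set.range B)) :
    ∃ M : ℕ → Matrix (Fin m) (Fin m) ℝ, (∀ k, M k ∈ Set.range B) ∧
      (∃ l : ℕ, 0 < l ∧ Function.Periodic M l) ∧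
      ∃ x : ℕ → EuclideanSpace ℝ (Fin m), IsTrajectory M x ∧ ¬ Tendsto x atTop (𝓝 0) := by
  by_contra! hcon
  obtain ⟨ρ, hρdef⟩ : ∃ ρ, ρ = jsr (Set.range B) := ⟨_, rfl⟩
  rw [← hρdef] at hρ
  have hρ0 : 0 < ρ := one_pos.trans hρ
  obtain ⟨a, ha⟩ : ∃ a : ℝ, a = (1 - ρ⁻¹) ^ m := ⟨_, rfl⟩
  have ha0 : 0 < a := ha ▸ pow_pos (sub_pos.2 (inv_lt_one_of_one_lt₀ hρ)) m
  -- The constant of `IsNorm.le_sub_act`, plus `1` so that it is positive even for `m = 0`. With `δ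
  -- = a / (2 * b)` one has `b * δ = a / 2`.
  obtain ⟨b, hb⟩ : ∃ b : ℝ, b = (m + 1) * (2 ^ m * m) + 1 := ⟨_, rfl⟩
  have hb0 : 0 < b := by rw [hb]; positivity
  have hδ0 : 0 < a / (2 * b) := by positivity
  obtain ⟨N, hN⟩ := exists_nat_gt ((1 + 2 / (a / (2 * b))) ^ m)
  have hN0 : 0 < N := by
    have : (0 : ℝ) < N := lt_trans (by positivity) hN
    exact_mod_cast this
  -- `N` is already fixed here, so `t` can be taken close enough to `ρ`; the norm, which depends on
  -- `t`, comes last.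
  obtain ⟨t, hρt, ht⟩ : ∃ t, ρ < t ∧ t ^ N / 2 < ρ ^ N := by
    have hcont : Tendsto (fun t : ℝ => t ^ N / 2) (𝓝[>] ρ) (𝓝 (ρ ^ N / 2)) :=
      ((((continuous_pow N).div_const 2).tendsto ρ)).mono_left nhdsWithin_le_nhds
    have h1 := hcont.eventually (gt_mem_nhds (half_lt_self (pow_pos hρ0 N)))
    obtain ⟨t, h2, h3⟩ := (h1.and self_mem_nhdsWithin).exists
    exact ⟨t, h3, h2⟩
  have ht0 : 0 < t := hρ0.trans hρt
  have ht1 : 1 < t := hρ.trans hρt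
  have hβ : jsr (Set.range B) < t := hρdef ▸ hρt
  obtain ⟨K, hK1, hK⟩ := exists_weightedNorm_le B hβ
  have hp := isNorm_weightedNorm B hβ
  have hle := norm_le_weightedNorm B hβ
  have hact := weightedNorm_act_le B hβ
  generalize weightedNorm B t = p at hp hK hle hact
  obtain ⟨u, x, hux⟩ := exists_lt_act_wordProd B (one_pos.trans_le hK1) hK hle hN0
    (c := t ^ N / 2) (by positivity) (hρdef ▸ ht)
  obtain ⟨i, k, hk, z, hz, hlt⟩ := hp.exists_almost_fixed hK hle ht0 hδ0 hN (fun j => B (u j))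
    (fun j => hact (u j)) hux
  obtain ⟨W, hW⟩ : ∃ W, W = wordProd k (fun j => B (u (i + j))) := ⟨_, rfl⟩
  rw [← hW] at hlt
  have htk : 0 < t ^ k := pow_pos ht0 k
  have hPle : ∀ z, p (act ((t ^ k)⁻¹ • W) z) ≤ p z := fun z => by
    rw [act_smul_left, hp.smul, abs_of_pos (inv_pos.2 htk), inv_mul_le_iff₀ htk, hW]
    exact act_wordProd_le ht0.le (fun j => B (u (i + j))) (fun j => hact _) k z
  -- Periodic decay puts the eigenvalues of `W` inside the unit disc; dividing by `t ^ k ≥ t > ρ`,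
  -- where `k ≥ 1`, brings them within `ρ⁻¹`.
  have hroots : ∀ v ∈ (((t ^ k)⁻¹ • W).charpoly.map Complex.ofRealHom).roots, ‖v‖ ≤ ρ⁻¹ := by
    intro v hv
    have h1 : t ^ k * ‖v‖ < 1 := by
      refine norm_root_charpoly_lt _ htk (fun z => ?_) hv
      rw [smul_smul, mul_inv_cancel₀ htk.ne', one_smul, hW]
      exact tendsto_act_pow_wordProd hcon (fun j => B (u (i + j))) (fun j => ⟨_, rfl⟩) hk z
    have h2 : ρ ≤ t ^ k := hρt.le.trans (le_self_pow₀ ht1.le hk.ne')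
    rw [← one_div, le_div_iff₀ hρ0, mul_comm]
    exact (mul_le_mul_of_nonneg_right h2 (norm_nonneg v)).trans h1.le
  have hfin := hp.le_sub_act _ hPle (inv_le_one_of_one_le₀ hρ.le) hroots z
  rw [hp.sub_comm, ← ha] at hfin
  -- The contradiction is `a / 2 ≤ a * p z ≤ b * p (P z - z) < b * δ = a / 2`.
  have h1 : a * (1 / 2) ≤ a * p z := mul_le_mul_of_nonneg_left hz ha0.le
  have h2 := mul_le_mul_of_nonneg_right (show (m + 1) * (2 ^ m * m) ≤ b by linarith)
    (hp.nonneg (act ((t ^ k)⁻¹ • W) z - z))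
  have h3 := mul_lt_mul_of_pos_left hlt hb0
  have h4 : b * (a / (2 * b)) = a * (1 / 2) := by field_simp
  linarith

end Instability

end

end DirectInclusion

open DirectInclusion in
theorem theorem2 {S A : Type*} [Fintype S] [Fintype A] [DecidableEq S] [DecidableEq A] {m : ℕ}
    (𝓜 : MDP S A)
    (d : S × A → ℝ) (hd_pos : ∀ sa, 0 < d sa) (hd_sum : ∑ sa, d sa = 1)
    (Φ : Matrix (S × A) (Fin m) ℝ) (hΦ : Φ.rank = m)
    (α : ℝ) (hα_pos : 0 < α) (hα_lt : α < 1) :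
    (rhoDir 𝓜 d Φ α < 1 →
      UniformlyExponentiallyStable (convexHull ℝ (modeFamily 𝓜 d Φ α)) ∧
      ∀ ε : ℝ, 0 < ε → rhoDir 𝓜 d Φ α + ε < 1 →
        (∀ x, Tendsto (fun t : ℕ => lyapunovTrunc 𝓜 d Φ α ε t x) atTop
          (𝓝 (lyapunov 𝓜 d Φ α ε x))) ∧
        IsNorm (pNorm 𝓜 d Φ α ε) ∧
        ∀ M ∈ convexHull ℝ (modeFamily 𝓜 d Φ α), ∀ x : EuclideanSpace ℝ (Fin m),
          pNorm 𝓜 d Φ α ε (act M x) ≤ (rhoDir 𝓜 d Φ α + ε) * pNorm 𝓜 d Φ α ε x) ∧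
    (1 < rhoDir 𝓜 d Φ α →
      ∃ M : ℕ → Matrix (Fin m) (Fin m) ℝ,
        (∀ k, M k ∈ convexHull ℝ (modeFamily 𝓜 d Φ α)) ∧
        (∃ l : ℕ, 0 < l ∧ Function.Periodic M l) ∧
        ∃ x : ℕ → EuclideanSpace ℝ (Fin m), IsTrajectory M x ∧ ¬ Tendsto x atTop (𝓝 0)) := by
  -- Without actions the weights `d` would sum to `0`; hence deterministic policies exist.
  have : Nonempty A := by
    by_contra hA
    rw [not_nonempty_iff] at hA
    simp at hd_sum
  refine ⟨fun hρ => ⟨uniformlyExponentiallyStable_convexHull (mode 𝓜 d Φ α) hρ,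
    fun ε hε _ => ?_⟩, fun hρ => ?_⟩
  · have hβ : jsr (Set.range (mode 𝓜 d Φ α)) < rhoDir 𝓜 d Φ α + ε := lt_add_of_pos_right _ hε
    -- `lyapunovTrunc` and `pNorm` are by definition `weightedTrunc` and `weightedNorm` of the
    -- family `mode 𝓜 d Φ α` with `β = rhoDir 𝓜 d Φ α + ε`.
    exact ⟨fun x => tendsto_weightedTrunc (mode 𝓜 d Φ α) hβ x,
      isNorm_weightedNorm (mode 𝓜 d Φ α) hβ,
      fun M hM x => weightedNorm_act_le_of_mem_convexHull (mode 𝓜 d Φ α) hβ hM x⟩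
  · obtain ⟨M, hM, hrest⟩ := exists_periodic_not_tendsto (mode 𝓜 d Φ α) hρ
    exact ⟨M, fun k => subset_convexHull ℝ _ (hM k), hrest⟩
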